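/- **Setup.** Let $G$ be a simple graph whose vertices are ordered $v_1,\dots,v_n$, $n\ge 1$. The ordering is *greedy* (a maximum cardinality search ordering) if for all $i\le j$ the number of neighbours of $v_i$ among $v_1,\dots,v_{i-1}$ is at least the number of neighbours of $v_j$ among $v_1,\dots,v_{i-1}$. For each $j$ let $W_j=(w_1,\dots,w_k)$ be the list, in increasing order, of those $v_h$ with $h<j$ that are not adjacent to $v_j$, and let $k(v_j)=|W_j|$. Fix $d\ge 1$. For each vertex $v_j$ introduce a class $\alpha(v_j)$ of *node variables* of arity $k(v_j)+1$: the independent variables $\alpha(v_j)_{s_1,\dots,s_{k+1}}$, $1\le s_1<\dots<s_{k+1}\le d$ ($k=k(v_j)$), extended to all index sequences in $\{1,\dots,d\}^{k+1}$ as an alternating function (zero if an index repeats, otherwise the variable with sorted indices times the sign of the sorting permutation). The *LSS tree* of $v_j$ is defined recursively: its top node is labeled $\alpha(v_j)$, and below this node hang, in order, the LSS trees of $w_1,\dots,w_k$, where $W_j=(w_1,\dots,w_k)$; each connection is called a conduit and is the upper conduit of the child. A *Type I LSS garden* is an LSS tree together with one uppermost conduit that leaves its top node and exits the diagram. A *Type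 II LSS garden* with top node labels $\alpha(v_j)$ and $\alpha(v_i)$ consists of the LSS trees of $v_j$ and $v_i$ whose top nodes share a single uppermost conduit, which is the upper conduit of both. An *index labeling* assigns to every conduit, including the uppermost one, an element of $\{1,\dots,d\}$. A node labeled $\alpha(v)$ whose lower conduits have labels $s_1,\dots,s_k$ (in order) and whose upper conduit has label $s_{k+1}$ contributes the factor $\alpha(v)_{s_1,\dots,s_k;s_{k+1}}$, and the *valuation* of the labeling is the product of the factors of all nodes; it is $0$ or $\pm$ a monomial in the independent variables. For Type I, the valuation is this product times the standard basis vector $\mathbf e_r$, where $r$ is the label of the uppermost conduit. A garden *evaluates* to the sum of the valuations of all its index labelings. Let $R$ be the $d\times n$ matrix whose $j$-th column is the vector to which the Type I LSS garden of $v_j$ evaluates, and let $T=R^{\top}R$ be the Gram matrix; its entries are integer polynomials in the independent node variables. Order the independent variables by priority: $\alpha(v_1)>\alpha(v_2)>\dots>\alpha(v_n)$ by class, and within one class by lexicographic order of the index sequences, lower indices having higher priority. Compare monomials lexicographically: the monomial with the larger exponent at the highest-priority variable in which the two differ has higher priority. **Lemma (Unique Monomial Lemma).** Suppose that the ordering $v_1,\dots,v_n$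 is greedy and $d\ge k(v_n)+1$. Let $g$ be the Type II LSS garden with top node labels $\alpha(v_j)$ and $\alpha(v_i)$, where $v_i=v_j$ or $v_i\sim v_j$ in $G$. Then some index labeling of $g$ has a nonzero valuation, and the highest-priority monomial occurring (up to sign) as a nonzero valuation occurs for exactly one index labeling of the conduits of $g$. Consequently its coefficient in the polynomial to which $g$ evaluates is $\pm 1$. This polynomial is the Gram matrix entry $t_{ji}$ of $T$, and so $t_{ji}$ is a nonzero polynomial. -/

import Mathlib

open MvPolynomial

noncomputable section

namespace HangingGarden

/-! ### Vertex orderings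

`v : Fin n ≃ V` is an ordering of the vertices of `G`; positions are elements of `Fin n`, so that
`v 0` is the first vertex. A vertex is referred to by its position. -/

section Orderings

variable {V : Type*} {n : ℕ}

open Classical in
/-- The local degree of the `j`-th vertex at stage `i`: the number of its neighbours among the
vertices that come strictly before position `i`. -/
def localDegree (G : SimpleGraph V) (v : Fin n ≃ V) (i j : Fin n) : ℕ :=
  ((Finset.Iio i).filter fun h : Fin n => G.Adj (v h) (v j)).card

/-- Greedy (maximum cardinality search) orderings. -/
def IsGreedy (G : SimpleGraph V) (v : Fin n ≃ V) : Prop :=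
  ∀ i j : Fin n, i ≤ j → localDegree G v i j ≤ localDegree G v i i

/-- The set of positions of vertices that precede the `j`-th one and are not adjacent to it. -/
def precursors (G : SimpleGraph V) (v : Fin n ≃ V) (j : Fin n) : Finset (Fin n) :=
  @Finset.filter (Fin n) (fun i => ¬ G.Adj (v i) (v j)) (Classical.decPred _) (Finset.Iio j)

/-- `k(v_j)`, the number of non-adjacent precursors. -/
def kNum (G : SimpleGraph V) (v : Fin n ≃ V) (j : Fin n) : ℕ := (precursors G v j).card

/-- The `s`-th entry of the list `W_j` of non-adjacent precursors, listed in increasing order. -/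
def precursor (G : SimpleGraph V) (v : Fin n ≃ V) (j : Fin n) (s : Fin (kNum G v j)) : Fin n :=
  (precursors G v j).orderEmbOfFin rfl s

theorem precursor_lt (G : SimpleGraph V) (v : Fin n ≃ V) (j : Fin n) (s : Fin (kNum G v j)) :
    precursor G v j s < j := by
  have h : precursor G v j s ∈ precursors G v j := Finset.orderEmbOfFin_mem _ rfl s
  exact Finset.mem_Iio.mp (@Finset.mem_filter _ _ (_) _ _ |>.mp h).1

end Orderings

/-! ### Node variables

There are `n` classes of node variables, and class `c` has arity `k c + 1`. Indices are elements
of `Fin d`. -/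

section NodeVariables

variable {n : ℕ}

/-- An independent node variable: a class and a strictly increasing sequence of indices. -/
structure IndepVar (k : Fin n → ℕ) (d : ℕ) where
  cls : Fin n
  idx : Fin (k cls + 1) → Fin d
  strictMono : StrictMono idx

/-- A node variable as an element of the lexicographic order: first the class, then the index
sequence. -/
def IndepVar.toKey {k : Fin n → ℕ} {d : ℕ} (x : IndepVar k d) :
    Σₗ c : Fin n, Lex (Fin (k c + 1) → Fin d) :=
  toLex ⟨x.cls, toLex x.idx⟩

theorem IndepVar.toKey_injective {k : Fin n → ℕ} {d : ℕ} :
    Function.Injective (IndepVar.toKey (k := k) (d := d)) := by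
  rintro ⟨c, s, hs⟩ ⟨c', s', hs'⟩ h
  have h1 : (⟨c, toLex s⟩ : Σ c : Fin n, Lex (Fin (k c + 1) → Fin d)) = ⟨c', toLex s'⟩ :=
    toLex.injective h
  obtain ⟨rfl, h2⟩ := Sigma.mk.inj_iff.mp h1
  obtain rfl : s = s' := toLex.injective (eq_of_heq h2)
  rfl

/-- The priority order on independent node variables; a smaller variable has higher priority. -/
instance IndepVar.instLinearOrder {k : Fin n → ℕ} {d : ℕ} : LinearOrder (IndepVar k d) :=
  LinearOrder.lift' IndepVar.toKey IndepVar.toKey_injective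

open Classical in
/-- The node variable of class `c` with arbitrary indices `s`, an alternating function of `s`:
it is zero if an index is repeated; otherwise it is the independent node variable with the indices
sorted, times the sign of the sorting permutation. -/
def nodeVar (k : Fin n → ℕ) (d : ℕ) (c : Fin n) (s : Fin (k c + 1) → Fin d) :
    MvPolynomial (IndepVar k d) ℤ :=
  if h : Function.Injective s then
    C ((Equiv.Perm.sign (Tuple.sort s) : ℤˣ) : ℤ) *
      X ⟨c, s ∘ Tuple.sort s,
        (Tuple.monotone_sort s).strictMono_of_injective (h.comp (Tuple.sort s).injective)⟩
  else 0

end NodeVariables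

/-! ### Hanging gardens without input boxes -/

section Gardens

variable {n : ℕ}

/-- A node together with everything hanging below it. The node has a class label `c` and `k c`
ordered lower conduits; lower conduit number `s` is at the same time the upper conduit of the top
node of the `s`-th child. -/
inductive NodeTree (k : Fin n → ℕ) : Type where
  | node (c : Fin n) (child : Fin (k c) → NodeTree k) : NodeTree k

namespace NodeTree

variable {k : Fin n → ℕ}

/-- The class label of the top node. -/
def label : NodeTree k → Fin n
  | node c _ => c

/-- The conduits strictly below the top node: `⟨s, none⟩` is the lower conduit number `s` of the
top node, and `⟨s, some e⟩` is the conduit `e` below the `s`-th child. -/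
def LowerConduit : NodeTree k → Type
  | node c child => Σ s : Fin (k c), Option (LowerConduit (child s))

instance instFiniteLowerConduit : (t : NodeTree k) → Finite (LowerConduit t)
  | node c child => by
    have := fun s => instFiniteLowerConduit (child s)
    unfold LowerConduit
    infer_instance

instance instFintypeLowerConduit (t : NodeTree k) : Fintype (LowerConduit t) := Fintype.ofFinite _

/-- The product of the factors of all nodes, when the upper conduit of the top node has index `u`
and the conduits below are indexed by `f`. -/
def nodeProduct (d : ℕ) :
    (t : NodeTree k) → Fin d → (LowerConduit t → Fin d) → MvPolynomial (IndepVar k d) ℤ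
  | node c child, u, f =>
    nodeVar k d c (Fin.snoc (α := fun _ => Fin d) (fun s => f ⟨s, none⟩) u) *
      ∏ s : Fin (k c), nodeProduct d (child s) (f ⟨s, none⟩) (fun e => f ⟨s, some e⟩)

end NodeTree

/-- A garden of Type I without input boxes: its uppermost conduit leaves the top node and exits
the diagram. -/
structure GardenI (k : Fin n → ℕ) where
  top : NodeTree k

/-- A garden of Type II without input boxes: its uppermost conduit joins the upper borders of the
two top nodes. -/
structure GardenII (k : Fin n → ℕ) where
  left : NodeTree k
  right : NodeTree k

variable {k : Fin n → ℕ}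

/-- All conduits; `none` is the uppermost one. -/
abbrev GardenI.Conduit (g : GardenI k) : Type := Option g.top.LowerConduit

/-- The valuation of an indexed Type I garden, a vector with at most one nonzero entry. -/
def GardenI.valuation (d : ℕ) (g : GardenI k) (f : g.Conduit → Fin d) :
    Fin d → MvPolynomial (IndepVar k d) ℤ :=
  Pi.single (f none) (g.top.nodeProduct d (f none) fun e => f (some e))

open Classical in
/-- The vector represented by a Type I garden. -/
def GardenI.value (d : ℕ) (g : GardenI k) : Fin d → MvPolynomial (IndepVar k d) ℤ :=
  ∑ f : g.Conduit → Fin d, g.valuation d f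

/-- All conduits; `none` is the uppermost one. -/
abbrev GardenII.Conduit (g : GardenII k) : Type :=
  Option (g.left.LowerConduit ⊕ g.right.LowerConduit)

/-- The valuation of an indexed Type II garden. -/
def GardenII.valuation (d : ℕ) (g : GardenII k) (f : g.Conduit → Fin d) :
    MvPolynomial (IndepVar k d) ℤ :=
  g.left.nodeProduct d (f none) (fun e => f (some (Sum.inl e))) *
    g.right.nodeProduct d (f none) (fun e => f (some (Sum.inr e)))

open Classical in
/-- The scalar represented by a Type II garden. -/
def GardenII.value (d : ℕ) (g : GardenII k) : MvPolynomial (IndepVar k d) ℤ :=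
  ∑ f : g.Conduit → Fin d, g.valuation d f

end Gardens

/-! ### LSS gardens and the Gram matrix -/

section LSS

variable {V : Type*} {n : ℕ}

/-- Below every node labeled by the `j`-th vertex, the lower conduits lead in order to nodes
labeled by the entries of the list `W_j`. -/
def NodeTree.IsLSS (G : SimpleGraph V) (v : Fin n ≃ V) : NodeTree (kNum G v) → Prop
  | .node j child =>
    ∀ s : Fin (kNum G v j), (child s).label = precursor G v j s ∧ NodeTree.IsLSS G v (child s)

/-- LSS gardens of Type II. -/
def GardenII.IsLSS (G : SimpleGraph V) (v : Fin n ≃ V) (g : GardenII (kNum G v)) : Prop :=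
  NodeTree.IsLSS G v g.left ∧ NodeTree.IsLSS G v g.right

/-- The LSS tree whose top node is labeled by the `j`-th vertex. -/
def lssTree (G : SimpleGraph V) (v : Fin n ≃ V) (j : Fin n) : NodeTree (kNum G v) :=
  .node j fun s => lssTree G v (precursor G v j s)
termination_by j
decreasing_by exact precursor_lt G v j s

theorem lssTree_label (G : SimpleGraph V) (v : Fin n ≃ V) (j : Fin n) :
    (lssTree G v j).label = j := by
  rw [lssTree, NodeTree.label]

theorem lssTree_isLSS (G : SimpleGraph V) (v : Fin n ≃ V) (j : Fin n) :
    NodeTree.IsLSS G v (lssTree G v j) := by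
  induction j using WellFoundedLT.induction with
  | ind j ih =>
    rw [lssTree, NodeTree.IsLSS]
    exact fun s => ⟨lssTree_label G v _, ih _ (precursor_lt G v j s)⟩

/-- The representation matrix, whose `j`-th column is the vector represented by the Type I LSS
garden with top node labeled by the `j`-th vertex. -/
def repMatrix (G : SimpleGraph V) (v : Fin n ≃ V) (d : ℕ) :
    Matrix (Fin d) (Fin n) (MvPolynomial (IndepVar (kNum G v) d) ℤ) :=
  Matrix.of fun r j => GardenI.value d ⟨lssTree G v j⟩ r

/-- The Gram matrix of the parametrized representation. -/
def gramMatrix (G : SimpleGraph V) (v : Fin n ≃ V) (d : ℕ) :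
    Matrix (Fin n) (Fin n) (MvPolynomial (IndepVar (kNum G v) d) ℤ) :=
  (repMatrix G v d).transpose * repMatrix G v d

end LSS

end HangingGarden

end

noncomputable section

namespace HangingGarden

/-! ### Sorted sequences -/

/-! Rank each conduit by the position of the node below it; the uppermost conduit gets the smaller
of the two top positions. Label the conduits in order of rank, always with the least label not used
by a conduit of smaller rank at a common node. This labeling `f₀` gives the unique highest-priority
monomial.

Let `f` be another labeling with nonzero valuation and let `c` be the least rank at which it differs
from `f₀`. At rank `c` it can only be larger, since the smaller labels are blocked by conduits where
the two agree. Nodes of class below `c` keep their variables. A node of class `c` has lower conduits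
of smaller rank, so only its upper label can change, and it increases, which lowers the priority of
the variable. Later classes cannot make up for this (`IsGreedyLabeling.starExponent_lt`).

Greediness of the ordering makes `f₀` explicit: the `s`-th entry of a list `W_j` has at most `s`
non-adjacent precursors, counting from zero (`IsGreedy.kNum_precursor_le`). Hence below a top node
the upper label of a node never blocks its lower conduits, which are labeled `0, 1, 2, ...`. At a
top node the lower conduits take these labels in order, omitting the uppermost label. Labels stay at
most the largest `k`, hence below `d`. -/

theorem sort_comp_le {m : ℕ} {α : Type*} [LinearOrder α] {s t : Fin m → α} (h : s ≤ t) :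
    s ∘ Tuple.sort s ≤ t ∘ Tuple.sort t := by
  intro p
  rw [← Tuple.lt_card_le_iff_apply_le_of_monotone (Tuple.monotone_sort s)]
  have h1 := (Tuple.lt_card_le_iff_apply_le_of_monotone (a := (t ∘ Tuple.sort t) p)
    (Tuple.monotone_sort t) (j := p)).mpr le_rfl
  refine h1.trans_le ?_
  -- The `p`-th sorted entry is at most `a` exactly when more than `p` entries are; such counts
  -- ignore order and can only shrink when entries grow.
  have key : ∀ u : Fin m → α, ∀ a : α,
      (Finset.univ.filter fun i => (u ∘ Tuple.sort u) i ≤ a).card =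
        (Finset.univ.filter fun i => u i ≤ a).card := by
    intro u a
    refine Finset.card_equiv (Tuple.sort u) fun i => ?_
    simp
  rw [key, key]
  exact Finset.card_le_card (Finset.monotone_filter_right _ fun i hi h2 => (h i).trans h2)

/-- Equal sorted sequences have equal ranges, and injectivity of `s` leaves only one place for its
last value in `t`. -/
theorem eq_of_sort_comp_eq {m : ℕ} {α : Type*} [LinearOrder α] {s t : Fin (m + 1) → α}
    (hs : Function.Injective s) (hinit : ∀ p, p ≠ Fin.last m → s p = t p)
    (h : s ∘ Tuple.sort s = t ∘ Tuple.sort t) : s = t := by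
  have hr : Set.range s = Set.range t := by
    have := congrArg Set.range h
    rwa [(Tuple.sort s).surjective.range_comp, (Tuple.sort t).surjective.range_comp] at this
  have hlast : s (Fin.last m) = t (Fin.last m) := by
    obtain ⟨p, hp⟩ : s (Fin.last m) ∈ Set.range t := hr ▸ Set.mem_range_self _
    by_cases hpl : p = Fin.last m
    · rw [← hp, hpl]
    · exact absurd (hs ((hinit p hpl).trans hp)) hpl
  funext p
  by_cases hpl : p = Fin.last m
  · rw [hpl, hlast]
  · exact hinit p hpl

/-! ### Lexicographic comparison of products of variables -/

/-- Smaller variables have higher priority, and `a x₀` is the least variable involved in any change.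
Exponents below it are equal, and at `a x₀` itself an occurrence is lost while none is gained. -/
theorem sum_single_lt_sum_single {X I : Type*} [Fintype X] [LinearOrder I] (a b : X → I) (x₀ : X)
    (h₀ : a x₀ < b x₀) (h : ∀ x, a x ≠ b x → a x₀ ≤ a x ∧ a x₀ < b x) :
    toLex (∑ x, Finsupp.single (b x) (1 : ℕ)) < toLex (∑ x, Finsupp.single (a x) (1 : ℕ)) := by
  rw [Finsupp.Lex.lt_iff]
  refine ⟨a x₀, fun z hz => ?_, ?_⟩
  · simp only [ofLex_toLex, Finsupp.finsetSum_apply]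
    refine Finset.sum_congr rfl fun x _ => ?_
    by_cases hx : a x = b x
    · rw [hx]
    · obtain ⟨h1, h2⟩ := h x hx
      rw [Finsupp.single_eq_of_ne (hz.trans h2).ne, Finsupp.single_eq_of_ne (hz.trans_le h1).ne]
  · simp only [ofLex_toLex, Finsupp.finsetSum_apply]
    refine Finset.sum_lt_sum (fun x _ => ?_) ⟨x₀, Finset.mem_univ _, ?_⟩
    · by_cases hx : a x = b x
      · rw [hx]
      · rw [Finsupp.single_eq_of_ne (h x hx).2.ne]
        exact Nat.zero_le _
    · rw [Finsupp.single_eq_of_ne h₀.ne, Finsupp.single_eq_same]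
      exact Nat.one_pos

/-! ### Independent node variables -/

section Variables

variable {n : ℕ} {k : Fin n → ℕ} {d : ℕ}

/-- The independent node variable of class `c` whose indices are those of `s`, sorted. -/
def sortedVar (c : Fin n) (s : Fin (k c + 1) → Fin d) (h : Function.Injective s) :
    IndepVar k d :=
  ⟨c, s ∘ Tuple.sort s,
    (Tuple.monotone_sort s).strictMono_of_injective (h.comp (Tuple.sort s).injective)⟩

theorem nodeVar_of_injective (c : Fin n) (s : Fin (k c + 1) → Fin d) (h : Function.Injective s) :
    nodeVar k d c s = C ((Equiv.Perm.sign (Tuple.sort s) : ℤˣ) : ℤ) * X (sortedVar c s h) := by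
  rw [nodeVar, dif_pos h, sortedVar]

theorem nodeVar_of_not_injective (c : Fin n) (s : Fin (k c + 1) → Fin d)
    (h : ¬ Function.Injective s) : nodeVar k d c s = 0 := by
  rw [nodeVar, dif_neg h]

theorem IndepVar.lt_of_cls_lt {x y : IndepVar k d} (h : x.cls < y.cls) : x < y :=
  Sigma.Lex.lt_def.mpr (Or.inl h)

theorem IndepVar.cls_le_of_le {x y : IndepVar k d} (h : x ≤ y) : x.cls ≤ y.cls :=
  not_lt.mp fun h' => (IndepVar.lt_of_cls_lt h').not_ge h

theorem sortedVar_lt {c : Fin n} {s t : Fin (k c + 1) → Fin d} (hs : Function.Injective s)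
    (ht : Function.Injective t) (hinit : ∀ p, p ≠ Fin.last _ → s p = t p)
    (hlast : s (Fin.last _) < t (Fin.last _)) : sortedVar c s hs < sortedVar c t ht := by
  have hle : s ≤ t := fun p => by
    by_cases hp : p = Fin.last _
    · rw [hp]; exact hlast.le
    · exact (hinit p hp).le
  have hne : s ∘ Tuple.sort s ≠ t ∘ Tuple.sort t := fun h => by
    rw [eq_of_sort_comp_eq hs hinit h] at hlast
    exact lt_irrefl _ hlast
  have hlt : s ∘ Tuple.sort s < t ∘ Tuple.sort t := lt_of_le_of_ne (sort_comp_le hle) hne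
  exact Sigma.Lex.lt_def.mpr (Or.inr ⟨rfl, Pi.toLex_strictMono hlt⟩)

end Variables

/-! ### Systems of nodes and conduits -/

section Systems

variable {n : ℕ} {k : Fin n → ℕ} {d : ℕ} {N E : Type*} [Fintype N]

/-- The product of the factors of a finite family of nodes, where `σ x` consists of the class of
the node `x` and its conduits, the upper one last. -/
def starProduct (d : ℕ) (σ : N → Σ c : Fin n, (Fin (k c + 1) → E)) (f : E → Fin d) :
    MvPolynomial (IndepVar k d) ℤ :=
  ∏ x, nodeVar k d (σ x).1 (f ∘ (σ x).2)

/-- At every node the incident conduits have distinct labels. -/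
def IsProper (σ : N → Σ c : Fin n, (Fin (k c + 1) → E)) (f : E → Fin d) : Prop :=
  ∀ x, Function.Injective (f ∘ (σ x).2)

/-- The exponents of the monomial contributed by a proper labeling. -/
def starExponent (σ : N → Σ c : Fin n, (Fin (k c + 1) → E)) (f : E → Fin d)
    (h : IsProper σ f) : IndepVar k d →₀ ℕ :=
  ∑ x, Finsupp.single (sortedVar (σ x).1 (f ∘ (σ x).2) (h x)) 1

theorem starProduct_of_isProper (σ : N → Σ c : Fin n, (Fin (k c + 1) → E)) (f : E → Fin d)
    (h : IsProper σ f) :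
    ∃ u : ℤˣ, starProduct d σ f = monomial (starExponent σ f h) (u : ℤ) := by
  refine ⟨∏ x, Equiv.Perm.sign (Tuple.sort (f ∘ (σ x).2)), ?_⟩
  rw [starProduct, Finset.prod_congr rfl fun x _ => nodeVar_of_injective _ _ (h x),
    Finset.prod_mul_distrib, ← map_prod, starExponent]
  rw [← mul_one (((∏ x, Equiv.Perm.sign (Tuple.sort (f ∘ (σ x).2)) : ℤˣ)) : ℤ), ← C_mul_monomial,
    monomial_sum_one, Units.coe_prod]
  rfl

theorem starProduct_of_not_isProper (σ : N → Σ c : Fin n, (Fin (k c + 1) → E)) (f : E → Fin d)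
    (h : ¬ IsProper σ f) : starProduct d σ f = 0 := by
  simp only [IsProper, not_forall] at h
  obtain ⟨x, hx⟩ := h
  exact Finset.prod_eq_zero (Finset.mem_univ x) (nodeVar_of_not_injective _ _ hx)

theorem mem_support_starProduct (σ : N → Σ c : Fin n, (Fin (k c + 1) → E)) (f : E → Fin d)
    (m : IndepVar k d →₀ ℕ) :
    m ∈ (starProduct d σ f).support ↔ ∃ h : IsProper σ f, m = starExponent σ f h := by
  by_cases h : IsProper σ f
  · obtain ⟨u, hu⟩ := starProduct_of_isProper σ f h
    rw [hu, support_monomial, if_neg u.ne_zero, Finset.mem_singleton]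
    exact ⟨fun hm => ⟨h, hm⟩, fun ⟨_, hm⟩ => hm⟩
  · rw [starProduct_of_not_isProper σ f h]
    simp [h]

/-- `f₀` labels the conduits greedily in the order given by `rank`: every smaller label is taken
by a neighboring conduit of smaller rank. -/
structure IsGreedyLabeling (σ : N → Σ c : Fin n, (Fin (k c + 1) → E)) (rank : E → Fin n)
    (f₀ : E → Fin d) : Prop where
  proper : IsProper σ f₀
  taken : ∀ e, ∀ l < f₀ e, ∃ e', rank e' < rank e ∧ f₀ e' = l ∧
    ∃ x, e ∈ Set.range (σ x).2 ∧ e' ∈ Set.range (σ x).2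
  lower : ∀ x p, p ≠ Fin.last _ → rank ((σ x).2 p) < (σ x).1
  upper : ∀ x, rank ((σ x).2 (Fin.last _)) ≤ (σ x).1
  top : ∀ e, ∃ x, (σ x).1 = rank e ∧ (σ x).2 (Fin.last _) = e

theorem IsGreedyLabeling.starExponent_lt {σ : N → Σ c : Fin n, (Fin (k c + 1) → E)}
    {rank : E → Fin n} {f₀ : E → Fin d} (H : IsGreedyLabeling σ rank f₀) {f : E → Fin d}
    (hf : IsProper σ f) (hne : f ≠ f₀) :
    toLex (starExponent σ f hf) < toLex (starExponent σ f₀ H.proper) := by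
  classical
  obtain ⟨e₁, he₁⟩ : ∃ e, f e ≠ f₀ e := Function.ne_iff.mp hne
  obtain ⟨c, ⟨e₀, he₀, hc⟩, hmin⟩ :=
    WellFounded.has_min (wellFounded_lt (α := Fin n)) {c | ∃ e, f e ≠ f₀ e ∧ rank e = c}
      ⟨_, e₁, he₁, rfl⟩
  have hlow : ∀ e, rank e < c → f e = f₀ e := fun e he => by
    by_contra h
    exact hmin _ ⟨e, h, rfl⟩ he
  -- A smaller label is held under `f₀` by a lower-ranked conduit at a common node; `f` agrees
  -- there, so it would repeat a label at that node.
  have hge : ∀ e, rank e = c → f₀ e ≤ f e := fun e he => by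
    by_contra! h
    obtain ⟨e', hr, hl, x, ⟨p, hp⟩, ⟨q, hq⟩⟩ := H.taken e (f e) h
    have h1 : f e' = f e := (hlow e' (he ▸ hr)).trans hl
    have h2 : q = p := hf x (by simp only [Function.comp_apply, hp, hq, h1])
    rw [← hp, ← hq, h2] at hr
    exact lt_irrefl _ hr
  have hge' : ∀ e, rank e ≤ c → f₀ e ≤ f e := fun e he =>
    he.lt_or_eq.elim (fun h => (hlow e h).ge) (hge e)
  set a : N → IndepVar k d := fun x => sortedVar (σ x).1 (f₀ ∘ (σ x).2) (H.proper x) with ha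
  set b : N → IndepVar k d := fun x => sortedVar (σ x).1 (f ∘ (σ x).2) (hf x) with hb
  have hinit : ∀ x, (σ x).1 ≤ c → ∀ p, p ≠ Fin.last _ →
      (f₀ ∘ (σ x).2) p = (f ∘ (σ x).2) p := fun x hx p hp =>
    (hlow _ ((H.lower x p hp).trans_le hx)).symm
  have hlt : ∀ x, (σ x).1 ≤ c → a x ≠ b x → a x < b x := by
    intro x hx hab
    refine sortedVar_lt _ _ (hinit x hx) ?_
    refine lt_of_le_of_ne (hge' _ ((H.upper x).trans hx)) fun heq => hab ?_
    have : f₀ ∘ (σ x).2 = f ∘ (σ x).2 := by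
      funext p
      by_cases hp : p = Fin.last _
      · rw [hp]; exact heq
      · exact hinit x hx p hp
    simp only [ha, hb, this]
  have hcls : ∀ x, a x ≠ b x → c ≤ (σ x).1 := by
    intro x hab
    by_contra! hx
    refine hab ?_
    have : f₀ ∘ (σ x).2 = f ∘ (σ x).2 := by
      funext p
      refine (hlow _ ?_).symm
      by_cases hp : p = Fin.last _
      · rw [hp]; exact (H.upper x).trans_lt hx
      · exact (H.lower x p hp).trans hx
    simp only [ha, hb, this]
  -- A node of class `c` with upper conduit `e₀` shows that some variable of class `c` really
  -- changes.
  obtain ⟨x₁, hx₁, hxe⟩ := H.top e₀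
  have hx₁c : (σ x₁).1 = c := hx₁.trans hc
  have hx₁ne : a x₁ < b x₁ := by
    refine sortedVar_lt _ _ (hinit x₁ hx₁c.le) ?_
    simp only [Function.comp_apply, hxe]
    exact lt_of_le_of_ne (hge e₀ hc) he₀.symm
  -- The comparison is decided at the changed node whose variable under `f₀` has highest priority,
  -- not necessarily at `x₁`.
  obtain ⟨x₀, hx₀, hx₀min⟩ := Finset.exists_min_image
    (Finset.univ.filter fun x => a x ≠ b x) a ⟨x₁, by simp [hx₁ne.ne]⟩
  simp only [Finset.mem_filter, Finset.mem_univ, true_and] at hx₀ hx₀min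
  have hx₀c : (σ x₀).1 ≤ c := by
    have h : (a x₀).cls ≤ (a x₁).cls := IndepVar.cls_le_of_le (hx₀min x₁ hx₁ne.ne)
    exact h.trans hx₁c.le
  refine sum_single_lt_sum_single a b x₀ (hlt x₀ hx₀c hx₀) fun x hx => ⟨hx₀min x hx, ?_⟩
  rcases (hcls x hx).lt_or_eq with hxc | hxc
  · exact IndepVar.lt_of_cls_lt (hx₀c.trans_lt hxc)
  · exact (hx₀min x hx).trans_lt (hlt x hxc.ge hx)

theorem IsGreedyLabeling.exists_unique_greatest [Fintype E] [DecidableEq E]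
    {σ : N → Σ c : Fin n, (Fin (k c + 1) → E)}
    {rank : E → Fin n} {f₀ : E → Fin d} (H : IsGreedyLabeling σ rank f₀) :
    ∃ m₀ : IndepVar k d →₀ ℕ,
      IsGreatest {m : Lex (IndepVar k d →₀ ℕ) |
        ∃ f : E → Fin d, ofLex m ∈ (starProduct d σ f).support} (toLex m₀) ∧
      (∃! f : E → Fin d, m₀ ∈ (starProduct d σ f).support) ∧
      ((∑ f : E → Fin d, starProduct d σ f).coeff m₀ = 1 ∨
        (∑ f : E → Fin d, starProduct d σ f).coeff m₀ = -1) := by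
  have hmem : starExponent σ f₀ H.proper ∈ (starProduct d σ f₀).support :=
    (mem_support_starProduct _ _ _).mpr ⟨H.proper, rfl⟩
  have huniq : ∀ f : E → Fin d, starExponent σ f₀ H.proper ∈ (starProduct d σ f).support →
      f = f₀ := by
    intro f hf
    obtain ⟨hp, hm⟩ := (mem_support_starProduct _ _ _).mp hf
    by_contra hne
    exact (H.starExponent_lt hp hne).ne (congrArg toLex hm.symm)
  refine ⟨starExponent σ f₀ H.proper, ⟨⟨f₀, hmem⟩, ?_⟩, ⟨f₀, hmem, huniq⟩, ?_⟩
  · rintro m ⟨f, hf⟩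
    obtain ⟨hp, hm⟩ := (mem_support_starProduct _ _ _).mp hf
    have hm' : m = toLex (starExponent σ f hp) := by rw [← hm, toLex_ofLex]
    rw [hm']
    by_cases hne : f = f₀
    · subst hne; exact le_rfl
    · exact (H.starExponent_lt hp hne).le
  · rw [coeff_sum, Finset.sum_eq_single f₀ (fun f _ hne => ?_) (fun h => (h (Finset.mem_univ _)).elim)]
    · obtain ⟨u, hu⟩ := starProduct_of_isProper σ f₀ H.proper
      rw [hu, coeff_monomial, if_pos rfl]
      exact (Int.units_eq_one_or u).imp (fun h => by rw [h]; rfl) (fun h => by rw [h]; rfl)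
    · exact notMem_support_iff.mp fun h => hne (huniq f h)

end Systems

/-! ### Nodes, conduits and greedy labels of a tree -/

section Trees
variable {n : ℕ} {k : Fin n → ℕ}
open NodeTree

/-- The class and the conduits of every node of a tree: `none` stands for the top node and its
upper conduit, `some e` for the lower conduit `e` and the node below it. -/
def NodeTree.nodeStar : (t : NodeTree k) → Option t.LowerConduit →
    Σ c : Fin n, (Fin (k c + 1) → Option t.LowerConduit)
  | node c _, none =>
    ⟨c, Fin.snoc (α := fun _ => Option (LowerConduit _)) (fun s => some ⟨s, none⟩) none⟩
  | node _ child, some ⟨s, x⟩ =>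
    ⟨(nodeStar (child s) x).1, fun p => some ⟨s, (nodeStar (child s) x).2 p⟩⟩

/-- The `s`-th natural number different from `u`. -/
def skip (u s : ℕ) : ℕ := if s < u then s else s + 1

/-- The greedy labeling of a tree whose uppermost conduit has label `u`. -/
def NodeTree.greedyLabel : (t : NodeTree k) → ℕ → Option t.LowerConduit → ℕ
  | node _ _, u, none => u
  | node _ child, u, some ⟨s, x⟩ => greedyLabel (child s) (skip u s) x

/-- The class of the node below each conduit, where `r` is used for the uppermost conduit. -/
def NodeTree.rank : (t : NodeTree k) → Fin n → Option t.LowerConduit → Fin n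
  | node _ _, r, none => r
  | node _ child, _, some ⟨s, x⟩ => rank (child s) (child s).label x

theorem NodeTree.nodeStar_castSucc (c : Fin n) (child : Fin (k c) → NodeTree k) (s : Fin (k c)) :
    ((node c child).nodeStar none).2 (Fin.castSucc s) = some ⟨s, none⟩ :=
  Fin.snoc_castSucc (α := fun _ => Option (LowerConduit (node c child))) (x := none)
    (p := fun s => some ⟨s, none⟩) s

theorem NodeTree.nodeStar_last (c : Fin n) (child : Fin (k c) → NodeTree k) :
    ((node c child).nodeStar none).2 (Fin.last _) = none :=
  Fin.snoc_last (α := fun _ => Option (LowerConduit (node c child))) (x := none)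
    (p := fun s => some ⟨s, none⟩)

theorem NodeTree.nodeProduct_eq_prod (d : ℕ) (t : NodeTree k) (f : Option t.LowerConduit → Fin d) :
    t.nodeProduct d (f none) (fun e => f (some e)) =
      ∏ x, nodeVar k d (t.nodeStar x).1 (f ∘ (t.nodeStar x).2) := by
  induction t with
  | node c child ih =>
    rw [Fintype.prod_option]
    -- A lower conduit is a child together with either that child's upper conduit or a conduit below
    -- it.
    have key : ∀ F : LowerConduit (node c child) → MvPolynomial (IndepVar k d) ℤ,
        ∏ e, F e = ∏ s : Fin (k c), ∏ x : Option (LowerConduit (child s)), F ⟨s, x⟩ := by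
      intro F
      refine Eq.trans ?_ (Fintype.prod_sigma
        (f := (F : (Σ s : Fin (k c), Option (LowerConduit (child s))) →
          MvPolynomial (IndepVar k d) ℤ)))
      congr! with _ _ _ _ hab
      exact congrArg F (eq_of_heq hab)
    rw [key, nodeProduct]
    congr 1
    · congr 1
      funext p
      refine Fin.lastCases ?_ (fun s => ?_) p
      · simp [nodeStar]
      · simp [nodeStar]
    · exact Finset.prod_congr rfl fun s _ => ih s (fun x => f (some ⟨s, x⟩))

@[simp] theorem NodeTree.greedyLabel_none (t : NodeTree k) (u : ℕ) :
    t.greedyLabel u none = u := by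
  cases t; rfl

@[simp] theorem NodeTree.rank_none (t : NodeTree k) (r : Fin n) : t.rank r none = r := by
  cases t; rfl

theorem skip_injective (u : ℕ) : Function.Injective (skip u) := by
  intro a b h
  unfold skip at h
  split_ifs at h <;> omega

theorem skip_ne (u s : ℕ) : skip u s ≠ u := by
  unfold skip
  split_ifs <;> omega

theorem le_skip (u s : ℕ) : s ≤ skip u s := by
  unfold skip
  split_ifs <;> omega

theorem skip_le (u s : ℕ) : skip u s ≤ s + 1 := by
  unfold skip
  split_ifs <;> omega

theorem NodeTree.greedyLabel_injective (t : NodeTree k) (u : ℕ) (x : Option t.LowerConduit) :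
    Function.Injective (t.greedyLabel u ∘ (t.nodeStar x).2) := by
  induction t generalizing u with
  | node c child ih =>
    rcases x with _ | ⟨s, x⟩
    · have hcast : ∀ s : Fin (k c), ((node c child).greedyLabel u ∘ ((node c child).nodeStar none).2)
          s.castSucc = skip u s := fun s => by
        simp [nodeStar, greedyLabel]
      have hlast : ((node c child).greedyLabel u ∘ ((node c child).nodeStar none).2)
          (Fin.last _) = u := by
        simp [nodeStar]
      intro p q
      refine Fin.lastCases ?_ (fun s => ?_) p <;> refine Fin.lastCases ?_ (fun s' => ?_) q
      · exact fun _ => rfl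
      · intro h
        exact (skip_ne u s' ((hcast s').symm.trans (h.symm.trans hlast))).elim
      · intro h
        exact (skip_ne u s ((hcast s).symm.trans (h.trans hlast))).elim
      · intro h
        rw [Fin.ext (skip_injective u ((hcast s).symm.trans (h.trans (hcast s'))))]
    · exact ih s (skip u s) x

theorem NodeTree.greedyLabel_lt {d : ℕ} (hk : ∀ c, k c < d) (t : NodeTree k) (u : ℕ) (hu : u < d)
    (x : Option t.LowerConduit) : t.greedyLabel u x < d := by
  induction t generalizing u with
  | node c child ih =>
    rcases x with _ | ⟨s, x⟩
    · exact hu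
    · exact ih s _ (((skip_le u s).trans s.isLt).trans_lt (hk c)) x

/-- Strict inequality can occur only at the top node: in a garden its upper conduit may be ranked by
the other, earlier top node. -/
theorem NodeTree.rank_upper_le (t : NodeTree k) (r : Fin n) (hr : r ≤ t.label)
    (x : Option t.LowerConduit) :
    t.rank r ((t.nodeStar x).2 (Fin.last _)) ≤ (t.nodeStar x).1 := by
  induction t generalizing r with
  | node c child ih =>
    rcases x with _ | ⟨s, x⟩
    · exact (congrArg _ (nodeStar_last c child)).trans_le hr
    · exact ih s _ le_rfl x

theorem NodeTree.exists_nodeStar_eq (t : NodeTree k) (r : Fin n) (x : Option t.LowerConduit)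
    (h : x = none → r = t.label) :
    (t.nodeStar x).1 = t.rank r x ∧ (t.nodeStar x).2 (Fin.last _) = x := by
  induction t generalizing r with
  | node c child ih =>
    rcases x with _ | ⟨s, x⟩
    · exact ⟨(h rfl).symm, nodeStar_last c child⟩
    · obtain ⟨h1, h2⟩ := ih s (child s).label x fun _ => rfl
      exact ⟨h1, congrArg (fun y => some (⟨s, y⟩ : LowerConduit (node c child))) h2⟩

end Trees

/-! ### Greedy orderings -/

section LSS

variable {V : Type*} {n : ℕ} {G : SimpleGraph V} {v : Fin n ≃ V}

theorem mem_precursors {j h : Fin n} :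
    h ∈ precursors G v j ↔ h < j ∧ ¬ G.Adj (v h) (v j) := by
  unfold precursors
  exact (@Finset.mem_filter _ _ (_) _ _).trans (and_congr_left' Finset.mem_Iio)

theorem precursor_mem (j : Fin n) (s : Fin (kNum G v j)) :
    precursor G v j s ∈ precursors G v j :=
  Finset.orderEmbOfFin_mem _ rfl s

theorem precursor_strictMono (j : Fin n) : StrictMono (precursor G v j) :=
  ((precursors G v j).orderEmbOfFin rfl).strictMono

theorem exists_precursor_eq {j h : Fin n} (hh : h ∈ precursors G v j) :
    ∃ s, precursor G v j s = h := by
  have : h ∈ Set.range ((precursors G v j).orderEmbOfFin rfl) := by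
    rw [Finset.range_orderEmbOfFin]
    exact hh
  exact this

theorem card_filter_precursors_add_localDegree {i j : Fin n} (hij : i ≤ j) :
    ((precursors G v j).filter (· < i)).card + localDegree G v i j = i := by
  classical
  have h1 : (precursors G v j).filter (· < i) =
      (Finset.Iio i).filter fun h => ¬ G.Adj (v h) (v j) := by
    ext h
    simp only [Finset.mem_filter, mem_precursors, Finset.mem_Iio]
    exact ⟨fun ⟨⟨_, h2⟩, h3⟩ => ⟨h3, h2⟩, fun ⟨h2, h3⟩ => ⟨⟨h2.trans_le hij, h3⟩, h2⟩⟩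
  have h2 := Finset.card_filter_add_card_filter_not (s := Finset.Iio i)
    (fun h => G.Adj (v h) (v j))
  rw [Fin.card_Iio] at h2
  rw [h1, localDegree, add_comm]
  convert h2

theorem card_filter_precursors_self (j : Fin n) :
    ((precursors G v j).filter (· < j)).card = kNum G v j := by
  rw [Finset.filter_true_of_mem fun h hh => (mem_precursors.mp hh).1, kNum]

/-- At stage `i` the vertex at `i` has at least as many earlier neighbors as the one at `j`, hence
at most as many earlier non-neighbors. -/
theorem IsGreedy.kNum_le_card (hG : IsGreedy G v) {i j : Fin n} (hij : i ≤ j) :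
    kNum G v i ≤ ((precursors G v j).filter (· < i)).card := by
  have h1 := card_filter_precursors_add_localDegree (G := G) (v := v) hij
  have h2 := card_filter_precursors_add_localDegree (G := G) (v := v) (le_refl i)
  rw [card_filter_precursors_self] at h2
  have h3 := hG i j hij
  omega

theorem IsGreedy.kNum_mono (hG : IsGreedy G v) : Monotone (kNum G v) := fun _ _ hij =>
  (hG.kNum_le_card hij).trans (Finset.card_filter_le _ _)

theorem lt_card_filter_precursors_iff {i j : Fin n} (s : Fin (kNum G v j)) :
    (s : ℕ) < ((precursors G v j).filter (· < i)).card ↔ precursor G v j s < i := by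
  rw [← Tuple.lt_card_lt_iff_apply_lt_of_monotone (precursor_strictMono j).monotone]
  have : (precursors G v j).filter (· < i) =
      (Finset.univ.filter fun s => precursor G v j s < i).map
        ⟨precursor G v j, (precursor_strictMono j).injective⟩ := by
    ext h
    simp only [Finset.mem_filter, Finset.mem_map, Finset.mem_univ, true_and,
      Function.Embedding.coeFn_mk]
    constructor
    · rintro ⟨h1, h2⟩
      obtain ⟨s, rfl⟩ := exists_precursor_eq h1
      exact ⟨s, h2, rfl⟩
    · rintro ⟨s, h1, rfl⟩
      exact ⟨precursor_mem j s, h1⟩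
  rw [this, Finset.card_map]

/-- Exactly `s` entries of `W_j` precede its `s`-th entry, so the greedy comparison at that entry
gives the bound. -/
theorem IsGreedy.kNum_precursor_le (hG : IsGreedy G v) (j : Fin n) (s : Fin (kNum G v j)) :
    kNum G v (precursor G v j s) ≤ s := by
  refine (hG.kNum_le_card (precursor_lt G v j s).le).trans ?_
  rw [← not_lt, lt_card_filter_precursors_iff]
  exact lt_irrefl _

open NodeTree

theorem NodeTree.rank_lower_lt (t : NodeTree (kNum G v)) (ht : t.IsLSS G v) (r : Fin n)
    (x : Option t.LowerConduit) (p : Fin (kNum G v (t.nodeStar x).1 + 1)) (hp : p ≠ Fin.last _) :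
    t.rank r ((t.nodeStar x).2 p) < (t.nodeStar x).1 := by
  induction t generalizing r with
  | node c child ih =>
    rw [IsLSS] at ht
    rcases x with _ | ⟨s, x⟩
    · obtain ⟨s, rfl⟩ := Fin.exists_castSucc_eq.mpr hp
      have h : (node c child).rank r (((node c child).nodeStar none).2 s.castSucc) =
          (child s).label := by
        exact (congrArg _ (nodeStar_castSucc c child s)).trans (rank_none _ _)
      rw [h, (ht s).1]
      exact precursor_lt G v c s
    · exact ih s (ht s).2 _ x p hp

/-- The hypothesis `hu` says that a lower conduit whose label was shifted past `u` comes later than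
the upper conduit, so that conduit may block `u`. -/
theorem NodeTree.exists_greedyLabel_eq (hG : IsGreedy G v) (t : NodeTree (kNum G v))
    (ht : t.IsLSS G v) (r : Fin n) (u : ℕ)
    (hu : ∀ s : Fin (kNum G v t.label), u ≤ s → r < precursor G v t.label s)
    (e : t.LowerConduit) (l : ℕ) (hl : l < t.greedyLabel u (some e)) :
    ∃ e', t.rank r e' < t.rank r (some e) ∧ t.greedyLabel u e' = l ∧
      ∃ x, some e ∈ Set.range (t.nodeStar x).2 ∧ e' ∈ Set.range (t.nodeStar x).2 := by
  induction t generalizing r u l with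
  | node c child ih =>
    rw [IsLSS] at ht
    have hmem : ∀ s : Fin (kNum G v c), some (⟨s, none⟩ : LowerConduit (node c child)) ∈
        Set.range ((node c child).nodeStar none).2 := fun s =>
      ⟨s.castSucc, nodeStar_castSucc c child s⟩
    have hmem' : none ∈ Set.range ((node c child).nodeStar none).2 := ⟨Fin.last _, nodeStar_last c child⟩
    have hlab : ∀ s : Fin (kNum G v c),
        (node c child).greedyLabel u (some ⟨s, none⟩) = skip u s := fun s => by
      simp [greedyLabel]
    have hrank : ∀ s : Fin (kNum G v c),
        (node c child).rank r (some ⟨s, none⟩) = precursor G v c s := fun s => by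
      simp [rank, (ht s).1]
    obtain ⟨s, _ | e⟩ := e
    · have hsib : ∀ s' : Fin (kNum G v c), s' < s → skip u s' = l → ∃ e',
          (node c child).rank r e' < (node c child).rank r (some ⟨s, none⟩) ∧
          (node c child).greedyLabel u e' = l ∧ ∃ x,
          some ⟨s, none⟩ ∈ Set.range ((node c child).nodeStar x).2 ∧
          e' ∈ Set.range ((node c child).nodeStar x).2 := fun s' hs' h =>
        ⟨some ⟨s', none⟩, by rw [hrank, hrank]; exact precursor_strictMono c hs',
          (hlab s').trans h, none, hmem s, hmem s'⟩
      have hl' : l < skip u s := (hlab s) ▸ hl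
      -- The label `l` is held by sibling `l` if `l < u`, by the upper conduit if `l = u`, and by
      -- sibling `l - 1` if `l > u`.
      rcases lt_trichotomy l u with h | h | h
      · have hls : l < s := by unfold skip at hl'; split_ifs at hl' <;> omega
        exact hsib ⟨l, hls.trans s.isLt⟩ hls (if_pos h)
      · have hus : u ≤ s := by unfold skip at hl'; split_ifs at hl' <;> omega
        refine ⟨none, ?_, ?_, none, hmem s, hmem'⟩
        · rw [hrank, rank_none]
          exact hu s hus
        · rw [greedyLabel_none, h]
      · have hls : l - 1 < s := by unfold skip at hl'; split_ifs at hl' <;> omega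
        refine hsib ⟨l - 1, hls.trans s.isLt⟩ hls ?_
        unfold skip
        split_ifs <;> simp only at * <;> omega
    · obtain ⟨e', h1, h2, x, ⟨p, hp⟩, ⟨q, hq⟩⟩ := ih s (ht s).2 (child s).label (skip u s)
        -- Vacuous below the top: the child has at most `s ≤ skip u s` lower conduits.
        (fun s' hs' => by
          have h1 := hG.kNum_precursor_le c s
          have h2 := s'.isLt
          have h3 := le_skip u s
          rw [← (ht s).1] at h1
          omega) e l hl
      exact ⟨some ⟨s, e'⟩, h1, h2, some ⟨s, x⟩,
        ⟨p, congrArg (fun y => some (⟨s, y⟩ : LowerConduit (node c child))) hp⟩,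
        ⟨q, congrArg (fun y => some (⟨s, y⟩ : LowerConduit (node c child))) hq⟩⟩

theorem NodeTree.IsLSS.eq_lssTree {t : NodeTree (kNum G v)} (ht : t.IsLSS G v) :
    t = lssTree G v t.label := by
  induction t with
  | node c child ih =>
    rw [IsLSS] at ht
    rw [label, lssTree]
    congr 1
    funext s
    rw [ih s (ht s).2, (ht s).1]

end LSS

/-! ### Gardens of Type II -/

section Gardens

variable {n : ℕ} {k : Fin n → ℕ} (g : GardenII k)

/-- The inclusion of the conduits of the left tree. -/
def GardenII.inLeft : Option g.left.LowerConduit → g.Conduit := Option.map Sum.inl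

/-- The inclusion of the conduits of the right tree. -/
def GardenII.inRight : Option g.right.LowerConduit → g.Conduit := Option.map Sum.inr

/-- The class and the conduits of every node of a garden. -/
def GardenII.nodeStar : Option g.left.LowerConduit ⊕ Option g.right.LowerConduit →
    Σ c : Fin n, (Fin (k c + 1) → g.Conduit)
  | Sum.inl x => ⟨(g.left.nodeStar x).1, g.inLeft ∘ (g.left.nodeStar x).2⟩
  | Sum.inr x => ⟨(g.right.nodeStar x).1, g.inRight ∘ (g.right.nodeStar x).2⟩

/-- Extend functions on the conduits of both trees to the garden, with value `a` at the uppermost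
conduit. -/
def GardenII.glue {g : GardenII k} {A : Type*} (a : A) (p : Option g.left.LowerConduit → A)
    (q : Option g.right.LowerConduit → A) : g.Conduit → A
  | none => a
  | some (Sum.inl e) => p (some e)
  | some (Sum.inr e) => q (some e)

theorem GardenII.glue_inLeft {A : Type*} (a : A) (p : Option g.left.LowerConduit → A)
    (q : Option g.right.LowerConduit → A) (h : p none = a) (x : Option g.left.LowerConduit) :
    glue a p q (g.inLeft x) = p x := by
  cases x
  · exact h.symm
  · rfl

theorem GardenII.glue_inRight {A : Type*} (a : A) (p : Option g.left.LowerConduit → A)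
    (q : Option g.right.LowerConduit → A) (h : q none = a) (x : Option g.right.LowerConduit) :
    glue a p q (g.inRight x) = q x := by
  cases x
  · exact h.symm
  · rfl

theorem GardenII.valuation_eq_starProduct (d : ℕ) (f : g.Conduit → Fin d) :
    g.valuation d f = starProduct d g.nodeStar f := by
  rw [starProduct, Fintype.prod_sum_type, GardenII.valuation]
  exact congrArg₂ (· * ·) (g.left.nodeProduct_eq_prod d (f ∘ g.inLeft))
    (g.right.nodeProduct_eq_prod d (f ∘ g.inRight))

end Gardens

/-! ### The greedy labeling of an LSS garden -/

section LSS

variable {V : Type*} {n : ℕ} {G : SimpleGraph V} {v : Fin n ≃ V}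

/-- The label `u` is the smallest one available for the uppermost conduit of the LSS garden with
top nodes `i` and `j`, at the stage `r` when it is labeled. -/
structure IsTopLabel (G : SimpleGraph V) (v : Fin n ≃ V) (i j r : Fin n) (u : ℕ) : Prop where
  left : ∀ s : Fin (kNum G v i), u ≤ s → r < precursor G v i s
  right : ∀ s : Fin (kNum G v j), u ≤ s → r < precursor G v j s
  le_left : r ≤ i
  le_right : r ≤ j
  rank_eq : r = i ∨ r = j
  label_le : u ≤ kNum G v i ∨ u ≤ kNum G v j
  taken : ∀ l < u, (∃ s : Fin (kNum G v i), (s : ℕ) = l ∧ precursor G v i s < r) ∨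
    ∃ s : Fin (kNum G v j), (s : ℕ) = l ∧ precursor G v j s < r

theorem IsTopLabel.symm {i j r : Fin n} {u : ℕ} (h : IsTopLabel G v i j r u) :
    IsTopLabel G v j i r u :=
  ⟨h.right, h.left, h.le_right, h.le_left, h.rank_eq.symm, h.label_le.symm,
    fun l hl => (h.taken l hl).symm⟩

theorem IsGreedy.isTopLabel_of_le (hG : IsGreedy G v) {i j : Fin n} (hij : i ≤ j)
    (hadj : v i = v j ∨ G.Adj (v i) (v j)) :
    IsTopLabel G v i j i ((precursors G v j).filter (· < i)).card where
  -- Vacuous, since `kNum G v i` is at most the chosen label.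
  left s hs := by
    have h1 := hG.kNum_le_card hij
    have h2 := s.isLt
    omega
  right s hs := by
    rw [← not_lt, lt_card_filter_precursors_iff, not_lt] at hs
    -- Equality would put `i` in the list `W_j`; this is where the vertices being equal or adjacent
    -- is needed.
    refine lt_of_le_of_ne hs fun h => ?_
    have hm := mem_precursors.mp (precursor_mem (G := G) (v := v) j s)
    rw [← h] at hm
    rcases hadj with hv | hv
    · exact hm.1.ne (v.injective hv)
    · exact hm.2 hv
  le_left := le_rfl
  le_right := hij
  rank_eq := Or.inl rfl
  label_le := Or.inr (Finset.card_filter_le _ _)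
  taken l hl := Or.inr ⟨⟨l, hl.trans_le (Finset.card_filter_le _ _)⟩, rfl,
    (lt_card_filter_precursors_iff _).mp hl⟩

theorem IsGreedy.exists_isTopLabel (hG : IsGreedy G v) (i j : Fin n)
    (hadj : v i = v j ∨ G.Adj (v i) (v j)) : ∃ r u, IsTopLabel G v i j r u := by
  rcases le_total i j with h | h
  · exact ⟨_, _, hG.isTopLabel_of_le h hadj⟩
  · exact ⟨_, _, (hG.isTopLabel_of_le h (hadj.imp Eq.symm SimpleGraph.Adj.symm)).symm⟩

theorem NodeTree.exists_greedyLabel_eq_upper (t : NodeTree (kNum G v)) (ht : t.IsLSS G v)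
    (r : Fin n) (u : ℕ) (s : Fin (kNum G v t.label)) (hs : (s : ℕ) < u)
    (hr : precursor G v t.label s < r) :
    ∃ e', t.rank r e' < r ∧ t.greedyLabel u e' = s ∧
      ∃ x, none ∈ Set.range (t.nodeStar x).2 ∧ e' ∈ Set.range (t.nodeStar x).2 := by
  cases t with
  | node c child =>
    rw [IsLSS] at ht
    refine ⟨some ⟨s, none⟩, ?_, ?_, none, ⟨Fin.last _, nodeStar_last c child⟩,
      ⟨s.castSucc, nodeStar_castSucc c child s⟩⟩
    · refine lt_of_eq_of_lt ?_ hr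
      exact (rank_none _ _).trans (ht s).1
    · exact (greedyLabel_none _ _).trans (if_pos hs)

theorem GardenII.exists_isGreedyLabeling (hG : IsGreedy G v) {d : ℕ} (hd : ∀ c, kNum G v c < d)
    (g : GardenII (kNum G v)) (hg : g.IsLSS G v)
    (hadj : v g.left.label = v g.right.label ∨ G.Adj (v g.left.label) (v g.right.label)) :
    ∃ rank, ∃ f₀ : g.Conduit → Fin d, IsGreedyLabeling g.nodeStar rank f₀ := by
  obtain ⟨r, u, H⟩ := hG.exists_isTopLabel _ _ hadj
  have hu : u < d := H.label_le.elim (fun h => h.trans_lt (hd _)) (fun h => h.trans_lt (hd _))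
  set p : Option g.left.LowerConduit → Fin d := fun x =>
    ⟨g.left.greedyLabel u x, g.left.greedyLabel_lt hd u hu x⟩ with hp
  set q : Option g.right.LowerConduit → Fin d := fun x =>
    ⟨g.right.greedyLabel u x, g.right.greedyLabel_lt hd u hu x⟩ with hq
  set f₀ : g.Conduit → Fin d := glue ⟨u, hu⟩ p q with hf₀
  set rank : g.Conduit → Fin n := glue r (g.left.rank r) (g.right.rank r) with hrank
  have fl : ∀ x, f₀ (g.inLeft x) = p x := g.glue_inLeft _ _ _ (by simp [hp])
  have fr : ∀ x, f₀ (g.inRight x) = q x := g.glue_inRight _ _ _ (by simp [hq])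
  have rl : ∀ x, rank (g.inLeft x) = g.left.rank r x := g.glue_inLeft _ _ _ (by simp)
  have rr : ∀ x, rank (g.inRight x) = g.right.rank r x := g.glue_inRight _ _ _ (by simp)
  have tl : ∀ e l, (∃ e', g.left.rank r e' < g.left.rank r e ∧ g.left.greedyLabel u e' = l ∧
      ∃ x, e ∈ Set.range (g.left.nodeStar x).2 ∧ e' ∈ Set.range (g.left.nodeStar x).2) →
      ∃ e', rank e' < rank (g.inLeft e) ∧ (f₀ e' : ℕ) = l ∧
        ∃ x, g.inLeft e ∈ Set.range (g.nodeStar x).2 ∧ e' ∈ Set.range (g.nodeStar x).2 := by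
    rintro e l ⟨e', h1, h2, x, ⟨a, ha⟩, ⟨b, hb⟩⟩
    exact ⟨g.inLeft e', by rwa [rl, rl], by rw [fl]; exact h2, Sum.inl x,
      ⟨a, congrArg g.inLeft ha⟩, ⟨b, congrArg g.inLeft hb⟩⟩
  have tr : ∀ e l, (∃ e', g.right.rank r e' < g.right.rank r e ∧ g.right.greedyLabel u e' = l ∧
      ∃ x, e ∈ Set.range (g.right.nodeStar x).2 ∧ e' ∈ Set.range (g.right.nodeStar x).2) →
      ∃ e', rank e' < rank (g.inRight e) ∧ (f₀ e' : ℕ) = l ∧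
        ∃ x, g.inRight e ∈ Set.range (g.nodeStar x).2 ∧ e' ∈ Set.range (g.nodeStar x).2 := by
    rintro e l ⟨e', h1, h2, x, ⟨a, ha⟩, ⟨b, hb⟩⟩
    exact ⟨g.inRight e', by rwa [rr, rr], by rw [fr]; exact h2, Sum.inr x,
      ⟨a, congrArg g.inRight ha⟩, ⟨b, congrArg g.inRight hb⟩⟩
  refine ⟨rank, f₀, ?_, ?_, ?_, ?_, ?_⟩
  · rintro (x | x) a b hab
    · refine g.left.greedyLabel_injective u x (Fin.val_eq_of_eq (?_ : p _ = p _))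
      rw [← fl, ← fl]
      exact hab
    · refine g.right.greedyLabel_injective u x (Fin.val_eq_of_eq (?_ : q _ = q _))
      rw [← fr, ← fr]
      exact hab
  · intro e l hl
    suffices h : ∃ e', rank e' < rank e ∧ (f₀ e' : ℕ) = l ∧
        ∃ x, e ∈ Set.range (g.nodeStar x).2 ∧ e' ∈ Set.range (g.nodeStar x).2 by
      obtain ⟨e', h1, h2, h3⟩ := h
      exact ⟨e', h1, Fin.ext h2, h3⟩
    rcases e with _ | e | e
    · rcases H.taken l hl with ⟨s, hs, hsr⟩ | ⟨s, hs, hsr⟩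
      · refine tl none l ?_
        rw [NodeTree.rank_none, ← hs]
        exact g.left.exists_greedyLabel_eq_upper hg.1 r u s (hs ▸ hl) hsr
      · refine tr none l ?_
        rw [NodeTree.rank_none, ← hs]
        exact g.right.exists_greedyLabel_eq_upper hg.2 r u s (hs ▸ hl) hsr
    · exact tl (some e) l (g.left.exists_greedyLabel_eq hG hg.1 r u H.left e l hl)
    · exact tr (some e) l (g.right.exists_greedyLabel_eq hG hg.2 r u H.right e l hl)
  · rintro (x | x) a ha
    · exact (rl _).trans_lt (g.left.rank_lower_lt hg.1 r x a ha)
    · exact (rr _).trans_lt (g.right.rank_lower_lt hg.2 r x a ha)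
  · rintro (x | x)
    · exact (rl _).trans_le (g.left.rank_upper_le r H.le_left x)
    · exact (rr _).trans_le (g.right.rank_upper_le r H.le_right x)
  · have el : ∀ e, (e = none → r = g.left.label) → ∃ x, (g.nodeStar x).1 = rank (g.inLeft e) ∧
        (g.nodeStar x).2 (Fin.last _) = g.inLeft e := fun e he =>
      have h := g.left.exists_nodeStar_eq r e he
      ⟨Sum.inl e, h.1.trans (rl e).symm, congrArg g.inLeft h.2⟩
    have er : ∀ e, (e = none → r = g.right.label) → ∃ x, (g.nodeStar x).1 = rank (g.inRight e) ∧
        (g.nodeStar x).2 (Fin.last _) = g.inRight e := fun e he =>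
      have h := g.right.exists_nodeStar_eq r e he
      ⟨Sum.inr e, h.1.trans (rr e).symm, congrArg g.inRight h.2⟩
    rintro (_ | e | e)
    · exact H.rank_eq.elim (fun h => el none fun _ => h) (fun h => er none fun _ => h)
    · exact el (some e) fun h => (Option.some_ne_none _ h).elim
    · exact er (some e) fun h => (Option.some_ne_none _ h).elim

end LSS

/-! ### The Gram matrix -/

section Gram

variable {n : ℕ} {k : Fin n → ℕ}

open Classical in
theorem GardenI.value_apply (d : ℕ) (g : GardenI k) (r : Fin d) :
    g.value d r = ∑ p : g.top.LowerConduit → Fin d, g.top.nodeProduct d r p := by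
  rw [GardenI.value, Finset.sum_apply,
    ← (Equiv.piOptionEquivProd (β := fun _ => Fin d)).symm.sum_comp, Fintype.sum_prod_type]
  simp only [GardenI.valuation, Equiv.piOptionEquivProd_symm_apply]
  rw [Finset.sum_eq_single r]
  · simp
  · intro b _ hb
    refine Finset.sum_eq_zero fun p _ => ?_
    exact Pi.single_eq_of_ne hb.symm _
  · exact fun h => (h (Finset.mem_univ _)).elim

open Classical in
-- Fixing the label of the shared conduit makes the two trees independent; summing over it gives the
-- scalar product.
theorem GardenII.value_eq_sum (d : ℕ) (g : GardenII k) :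
    g.value d = ∑ r, GardenI.value d ⟨g.left⟩ r * GardenI.value d ⟨g.right⟩ r := by
  rw [GardenII.value, ← (Equiv.piOptionEquivProd (β := fun _ => Fin d)).symm.sum_comp,
    Fintype.sum_prod_type]
  refine Finset.sum_congr rfl fun r _ => ?_
  rw [GardenI.value_apply, GardenI.value_apply, Finset.sum_mul_sum,
    ← (Equiv.sumArrowEquivProdArrow _ _ _).symm.sum_comp, Fintype.sum_prod_type]
  rfl

theorem gramMatrix_apply {V : Type*} {G : SimpleGraph V} {v : Fin n ≃ V} (d : ℕ)
    (g : GardenII (kNum G v)) (hg : g.IsLSS G v) :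
    gramMatrix G v d g.left.label g.right.label = g.value d := by
  rw [GardenII.value_eq_sum, hg.1.eq_lssTree, hg.2.eq_lssTree, lssTree_label, lssTree_label]
  rfl

end Gram

end HangingGarden

end

theorem mainTheorem6 {V : Type*} (G : SimpleGraph V) (n : ℕ) (hn : 0 < n) (v : Fin n ≃ V)
    (hgreedy : HangingGarden.IsGreedy G v)
    (d : ℕ) (hd : HangingGarden.kNum G v ⟨n - 1, Nat.sub_one_lt_of_lt hn⟩ + 1 ≤ d)
    (i j : Fin n) (hij : v i = v j ∨ G.Adj (v i) (v j))
    (g : HangingGarden.GardenII (HangingGarden.kNum G v))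
    (hg : HangingGarden.GardenII.IsLSS G v g)
    (hleft : g.left.label = j) (hright : g.right.label = i) :
    (∃ m₀ : HangingGarden.IndepVar (HangingGarden.kNum G v) d →₀ ℕ,
      IsGreatest {m : Lex (HangingGarden.IndepVar (HangingGarden.kNum G v) d →₀ ℕ) |
        ∃ f : g.Conduit → Fin d, ofLex m ∈ (g.valuation d f).support} (toLex m₀) ∧
      (∃! f : g.Conduit → Fin d, m₀ ∈ (g.valuation d f).support) ∧
      ((g.value d).coeff m₀ = 1 ∨ (g.value d).coeff m₀ = -1)) ∧
    HangingGarden.gramMatrix G v d j i = g.value d ∧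
    HangingGarden.gramMatrix G v d j i ≠ 0 := by
  classical
  subst hleft hright
  -- Greediness makes `kNum` monotone, so the bound at the last vertex serves all vertices.
  have hk : ∀ c, HangingGarden.kNum G v c < d := fun c =>
    (hgreedy.kNum_mono (Fin.le_def.mpr (Nat.le_sub_one_of_lt c.isLt))).trans_lt hd
  obtain ⟨rank, f₀, H⟩ := g.exists_isGreedyLabeling hgreedy hk hg
    (hij.imp Eq.symm SimpleGraph.Adj.symm)
  have hgram := HangingGarden.gramMatrix_apply d g hg
  obtain ⟨m₀, h1, h2, h3⟩ := H.exists_unique_greatest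
  simp only [← HangingGarden.GardenII.valuation_eq_starProduct] at h1 h2 h3
  have h4 : (g.value d).coeff m₀ = 1 ∨ (g.value d).coeff m₀ = -1 := by
    rw [HangingGarden.GardenII.value]
    convert h3
  refine ⟨⟨m₀, h1, h2, h4⟩, hgram, ?_⟩
  rw [hgram]
  intro h0
  rw [h0, MvPolynomial.coeff_zero] at h4
  omega
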